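/- A residuated lattice (RL) is an algebra $\langle M,\wedge,\vee,\cdot,1,\backslash,/\rangle$ such that $\langle M,\wedge,\vee\rangle$ is a lattice, $\langle M,\cdot,1\rangle$ is a monoid, and $b\le a\backslash c \iff a\cdot b\le c\iff a\le c/b$ for all $a,b,c\in M$. It is integral if $1$ is its top element; cancellative if $ax\le bx$ implies $a\le b$ and $xa\le xb$ implies $a\le b$; distributive if its lattice reduct is distributive; and dually well-partially-ordered (dually wpo) if its order has no infinite ascending chains and no infinite antichains. A nucleus on an RL $L$ is a monotone map $\gamma\colon L\to L$ with $a\le\gamma(a)=\gamma(\gamma(a))$ and $\gamma(a)\cdot\gamma(b)\le\gamma(a\cdot b)$. The nuclear image $L_\gamma$ is the RL of the elements $a$ with $\gamma(a)=a$, with the order, meets and residuals inherited from $L$, product $\gamma(a\cdot b)$, unit $\gamma(1)$ and join $\gamma(a\vee b)$. We say that an RL $M$ is a nuclear image of $L$ if $M$ is isomorphic to $L_\gamma$ for some nucleus $\gamma$ on $L$. Theorem. The following classes of residuated lattices coincide: (i) dually wpo integral RLs; (ii) dually wpo nuclear images of integral cancellative RLs; (iii) dually wpo nuclear images of distributive integral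 cancellative RLs satisfying $x(y\wedge z)=xy\wedge xz$ and $(x\wedge y)z=xz\wedge yz$. In particular, for a finite residuated lattice $M$ the following are equivalent: $M$ is integral; $M$ is a nuclear image of an integral cancellative RL; $M$ is a nuclear image of a cancellative RL. -/

import Mathlib

universe u

/-- A residuated lattice: a lattice and a monoid, with residuals `a \ c = lres a c` and
`c / b = rres c b` satisfying `b ≤ a \ c ↔ a * b ≤ c ↔ a ≤ c / b`.  (That multiplication is
isotone follows from residuation, see `ResiduatedLattice.mul_mono` below.) -/
class ResiduatedLattice (α : Type*) extends Lattice α, Monoid α where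
  /-- The residual `a \ c`. -/
  lres : α → α → α
  /-- The residual `c / b`. -/
  rres : α → α → α
  le_lres_iff : ∀ a b c : α, b ≤ lres a c ↔ a * b ≤ c
  le_rres_iff : ∀ a b c : α, a ≤ rres c b ↔ a * b ≤ c

namespace ResiduatedLattice

theorem mul_mono {α : Type*} [ResiduatedLattice α] {a b c d : α} (h : a ≤ b) (k : c ≤ d) :
    a * c ≤ b * d := by
  have h1 : a * c ≤ b * c := (le_rres_iff _ _ _).1 (h.trans ((le_rres_iff _ _ _).2 le_rfl))
  have h2 : b * c ≤ b * d := (le_lres_iff _ _ _).1 (k.trans ((le_lres_iff _ _ _).2 le_rfl))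
  exact h1.trans h2

/-- `1` is the top element. -/
def IsIntegral (α : Type*) [ResiduatedLattice α] : Prop :=
  ∀ a : α, a ≤ 1

/-- Both order-cancellation laws. -/
def IsCancellative (α : Type*) [ResiduatedLattice α] : Prop :=
  (∀ a b x : α, a * x ≤ b * x → a ≤ b) ∧ (∀ a b x : α, x * a ≤ x * b → a ≤ b)

/-- The underlying lattice is distributive. -/
def IsDistributive (α : Type*) [ResiduatedLattice α] : Prop :=
  ∀ x y z : α, x ⊓ (y ⊔ z) = (x ⊓ y) ⊔ (x ⊓ z)

/-- Multiplication distributes rres binary meets on both sides. -/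
def MulDistribInf (α : Type*) [ResiduatedLattice α] : Prop :=
  (∀ x y z : α, x * (y ⊓ z) = x * y ⊓ x * z) ∧ (∀ x y z : α, (x ⊓ y) * z = x * z ⊓ y * z)

/-- A dual well-partial-order: no infinite (strictly) ascending chains, no infinite antichains. -/
def IsDuallyWPO (α : Type*) [PartialOrder α] : Prop :=
  (¬ ∃ f : ℕ → α, StrictMono f) ∧ ∀ s : Set α, IsAntichain (· ≤ ·) s → s.Finite

/-- A nucleus: a closure operator `γ` with `γ a * γ b ≤ γ (a * b)`. -/
structure RLNucleus (α : Type*) [ResiduatedLattice α] extends ClosureOperator α where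
  map_mul_le' : ∀ a b : α, toFun a * toFun b ≤ toFun (a * b)

namespace RLNucleus

variable {α : Type*} [ResiduatedLattice α]

instance : CoeFun (RLNucleus α) (fun _ => α → α) := ⟨fun γ => γ.toFun⟩

theorem mono (γ : RLNucleus α) {a b : α} (h : a ≤ b) : γ a ≤ γ b := γ.monotone' h

theorem le_map (γ : RLNucleus α) (a : α) : a ≤ γ a := γ.le_closure' a

theorem map_map (γ : RLNucleus α) (a : α) : γ (γ a) = γ a := γ.idempotent' a

theorem map_mul_le (γ : RLNucleus α) (a b : α) : γ a * γ b ≤ γ (a * b) := γ.map_mul_le' a b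

theorem map_le (γ : RLNucleus α) {a b : α} (hb : γ b = b) (h : a ≤ b) : γ a ≤ b :=
  (γ.mono h).trans hb.le

theorem map_map_mul (γ : RLNucleus α) (a b : α) : γ (γ a * b) = γ (a * b) :=
  le_antisymm
    (γ.map_le (γ.map_map _) ((mul_mono le_rfl (γ.le_map b)).trans (γ.map_mul_le a b)))
    (γ.mono (mul_mono (γ.le_map a) le_rfl))

theorem map_mul_map (γ : RLNucleus α) (a b : α) : γ (a * γ b) = γ (a * b) :=
  le_antisymm
    (γ.map_le (γ.map_map _) ((mul_mono (γ.le_map a) le_rfl).trans (γ.map_mul_le a b)))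
    (γ.mono (mul_mono le_rfl (γ.le_map b)))

theorem map_lres (γ : RLNucleus α) (a c : α) (hc : γ c = c) : γ (lres a c) = lres a c := by
  refine le_antisymm ((le_lres_iff _ _ _).2 ?_) (γ.le_map _)
  calc a * γ (lres a c) ≤ γ (a * γ (lres a c)) := γ.le_map _
    _ = γ (a * lres a c) := γ.map_mul_map _ _
    _ ≤ c := γ.map_le hc ((le_lres_iff _ _ _).1 le_rfl)

theorem map_rres (γ : RLNucleus α) (c b : α) (hc : γ c = c) : γ (rres c b) = rres c b := by
  refine le_antisymm ((le_rres_iff _ _ _).2 ?_) (γ.le_map _)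
  calc γ (rres c b) * b ≤ γ (γ (rres c b) * b) := γ.le_map _
    _ = γ (rres c b * b) := γ.map_map_mul _ _
    _ ≤ c := γ.map_le hc ((le_rres_iff _ _ _).1 le_rfl)

/-- The carrier of the nuclear image: the closed elements, with the inherited order. -/
def Image (γ : RLNucleus α) : Type _ := {a : α // γ a = a}

/-- The nuclear image as a residuated lattice: the order, meets and residuals are inherited,
the product is `γ (a * b)`, the unit is `γ 1`, the join is `γ (a ⊔ b)`. -/
instance (γ : RLNucleus α) : ResiduatedLattice γ.Image where
  le a b := a.1 ≤ b.1
  le_refl a := le_refl a.1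
  le_trans a b c h k := le_trans (a := a.1) h k
  le_antisymm a b h k := Subtype.ext (le_antisymm h k)
  sup a b := ⟨γ (a.1 ⊔ b.1), γ.map_map _⟩
  le_sup_left a b := le_sup_left.trans (γ.le_map (a.1 ⊔ b.1))
  le_sup_right a b := le_sup_right.trans (γ.le_map (a.1 ⊔ b.1))
  sup_le a b c h k := γ.map_le c.2 (sup_le (a := a.1) h k)
  inf a b := ⟨a.1 ⊓ b.1, le_antisymm
    (le_inf (γ.map_le a.2 inf_le_left) (γ.map_le b.2 inf_le_right)) (γ.le_map _)⟩
  inf_le_left a b := inf_le_left (a := a.1)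
  inf_le_right a b := inf_le_right (a := a.1)
  le_inf a b c h k := le_inf (a := b.1) (b := c.1) h k
  mul a b := ⟨γ (a.1 * b.1), γ.map_map _⟩
  mul_assoc a b c := Subtype.ext <| by
    change γ (γ (a.1 * b.1) * c.1) = γ (a.1 * γ (b.1 * c.1))
    rw [γ.map_map_mul, γ.map_mul_map, mul_assoc]
  one := ⟨γ 1, γ.map_map _⟩
  one_mul a := Subtype.ext <| by
    change γ (γ 1 * a.1) = a.1
    rw [γ.map_map_mul, one_mul, a.2]
  mul_one a := Subtype.ext <| by
    change γ (a.1 * γ 1) = a.1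
    rw [γ.map_mul_map, mul_one, a.2]
  lres a c := ⟨lres a.1 c.1, γ.map_lres _ _ c.2⟩
  rres c b := ⟨rres c.1 b.1, γ.map_rres _ _ c.2⟩
  le_lres_iff a b c := (le_lres_iff a.1 b.1 c.1).trans
    ⟨fun h => γ.map_le c.2 h, fun h => (γ.le_map (a.1 * b.1)).trans h⟩
  le_rres_iff a b c := (le_rres_iff a.1 b.1 c.1).trans
    ⟨fun h => γ.map_le c.2 h, fun h => (γ.le_map (a.1 * b.1)).trans h⟩

end RLNucleus

/-- `α` is (up to isomorphism) the nuclear image of `β` with respect to some nucleus.  An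
isomorphism of residuated lattices is an order isomorphism preserving products: unit, meets, joins
and residuals are determined by the order and the product, hence preserved as well. -/
def IsNuclearImageOf (α β : Type*) [ResiduatedLattice α] [ResiduatedLattice β] : Prop :=
  ∃ γ : RLNucleus β, Nonempty (α ≃*o γ.Image)

end ResiduatedLattice

/-! Take for `L` the nonempty two-sided ideals of words over `M`. Comparing lengths in two
factorizations of one word shows that `L` is cancellative and that products distribute over meets
(`WordIdeal.isCancellative`, `WordIdeal.mulDistribInf`). Without infinite ascending chains every
nonempty subset of `M` has a join, so an ideal can be sent to the join of the products of its words.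
This map `wordSup` is multiplicative, by residuation, and left adjoint to `wordsBelow`, so the
induced closure is a nucleus. One-letter words make `wordSup` a retraction of `wordsBelow`, which
identifies `M` with the nuclear image. Conversely, nuclear images inherit integrality. If `L` is
only cancellative, a top `t` of `M` satisfies `t * t ≤ 1 * t` when read in `L`, and cancelling `t`
gives `t ≤ 1`. -/

/-! ### Ideals of words as a residuated lattice. -/

/-- A nonempty two-sided ideal of the free monoid of words over `X`. -/
@[ext]
structure WordIdeal (X : Type*) where
  /-- The words of the ideal. -/
  carrier : Set (List X)
  nonempty : carrier.Nonempty
  append_left : ∀ u {v : List X}, v ∈ carrier → u ++ v ∈ carrier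
  append_right : ∀ {u : List X} (v), u ∈ carrier → u ++ v ∈ carrier

namespace WordIdeal

variable {X : Type*}

/-- The complex product of two ideals. -/
protected def mul (I J : WordIdeal X) : WordIdeal X where
  carrier := {w | ∃ u ∈ I.carrier, ∃ v ∈ J.carrier, u ++ v = w}
  nonempty := by
    obtain ⟨u, hu⟩ := I.nonempty
    obtain ⟨v, hv⟩ := J.nonempty
    exact ⟨_, u, hu, v, hv, rfl⟩
  append_left := by
    rintro x _ ⟨u, hu, v, hv, rfl⟩
    exact ⟨x ++ u, I.append_left x hu, v, hv, List.append_assoc _ _ _⟩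
  append_right := by
    rintro _ x ⟨u, hu, v, hv, rfl⟩
    exact ⟨u, hu, v ++ x, J.append_right x hv, (List.append_assoc _ _ _).symm⟩

/-- Ideals ordered by inclusion, with the complex product, form a residuated lattice. -/
instance : ResiduatedLattice (WordIdeal X) where
  le I J := I.carrier ⊆ J.carrier
  le_refl I := subset_rfl
  le_trans I J K h k := h.trans k
  le_antisymm I J h k := WordIdeal.ext (h.antisymm k)
  sup I J :=
    { carrier := I.carrier ∪ J.carrier
      nonempty := I.nonempty.inl
      append_left := fun u _ h => h.imp (I.append_left u) (J.append_left u)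
      append_right := fun v h => h.imp (I.append_right v) (J.append_right v) }
  le_sup_left I J := Set.subset_union_left
  le_sup_right I J := Set.subset_union_right
  sup_le I J K h k := Set.union_subset h k
  inf I J :=
    { carrier := I.carrier ∩ J.carrier
      nonempty := by
        obtain ⟨u, hu⟩ := I.nonempty
        obtain ⟨v, hv⟩ := J.nonempty
        -- Two-sidedness keeps meets nonempty.
        exact ⟨u ++ v, I.append_right v hu, J.append_left u hv⟩
      append_left := fun u _ h => ⟨I.append_left u h.1, J.append_left u h.2⟩
      append_right := fun v h => ⟨I.append_right v h.1, J.append_right v h.2⟩ }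
  inf_le_left I J := Set.inter_subset_left
  inf_le_right I J := Set.inter_subset_right
  le_inf I J K h k := Set.subset_inter h k
  mul := WordIdeal.mul
  mul_assoc I J K := WordIdeal.ext <| Set.ext fun w => by
    constructor
    · rintro ⟨_, ⟨a, ha, b, hb, rfl⟩, c, hc, rfl⟩
      exact ⟨a, ha, b ++ c, ⟨b, hb, c, hc, rfl⟩, (List.append_assoc _ _ _).symm⟩
    · rintro ⟨a, ha, _, ⟨b, hb, c, hc, rfl⟩, rfl⟩
      exact ⟨a ++ b, ⟨a, ha, b, hb, rfl⟩, c, hc, List.append_assoc _ _ _⟩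
  one :=
    { carrier := Set.univ
      nonempty := ⟨[], trivial⟩
      append_left := fun _ _ _ => trivial
      append_right := fun _ _ => trivial }
  one_mul I := WordIdeal.ext <| Set.ext fun w => by
    constructor
    · rintro ⟨a, -, b, hb, rfl⟩
      exact I.append_left a hb
    · exact fun h => ⟨[], trivial, w, h, rfl⟩
  mul_one I := WordIdeal.ext <| Set.ext fun w => by
    constructor
    · rintro ⟨a, ha, b, -, rfl⟩
      exact I.append_right b ha
    · exact fun h => ⟨w, h, [], trivial, List.append_nil w⟩
  lres I K :=
    { carrier := {v | ∀ u ∈ I.carrier, u ++ v ∈ K.carrier}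
      nonempty := K.nonempty.imp fun _ hv u _ => K.append_left u hv
      append_left := fun x v h u hu => by
        rw [← List.append_assoc]
        exact h _ (I.append_right x hu)
      append_right := fun x h u hu => by
        rw [← List.append_assoc]
        exact K.append_right x (h u hu) }
  rres K J :=
    { carrier := {u | ∀ v ∈ J.carrier, u ++ v ∈ K.carrier}
      nonempty := K.nonempty.imp fun _ hu v _ => K.append_right v hu
      append_left := fun x u h v hv => by
        rw [List.append_assoc]
        exact K.append_left x (h v hv)
      append_right := fun x h v hv => by
        rw [List.append_assoc]
        exact h _ (J.append_left x hv) }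
  le_lres_iff I J K := by
    constructor
    · rintro h _ ⟨u, hu, v, hv, rfl⟩
      exact h hv u hu
    · exact fun h v hv u hu => h ⟨u, hu, v, hv, rfl⟩
  le_rres_iff I J K := by
    constructor
    · rintro h _ ⟨u, hu, v, hv, rfl⟩
      exact h hu v hv
    · exact fun h u hu v hv => h ⟨u, hu, v, hv, rfl⟩

theorem mem_mul {I J : WordIdeal X} {w : List X} :
    w ∈ (I * J).carrier ↔ ∃ u ∈ I.carrier, ∃ v ∈ J.carrier, u ++ v = w := Iff.rfl

theorem isIntegral : ResiduatedLattice.IsIntegral (WordIdeal X) :=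
  fun _ => Set.subset_univ _

theorem isDistributive : ResiduatedLattice.IsDistributive (WordIdeal X) :=
  fun I J K => WordIdeal.ext (Set.inter_union_distrib_left I.carrier J.carrier K.carrier)

theorem exists_shortest (I : WordIdeal X) :
    ∃ u ∈ I.carrier, ∀ v ∈ I.carrier, u.length ≤ v.length := by
  obtain ⟨u, hu, h⟩ := exists_minimalFor_of_wellFoundedLT (· ∈ I.carrier) List.length I.nonempty
  exact ⟨u, hu, fun v hv => (le_total u.length v.length).elim id (h hv)⟩

/-- Append a shortest word of `K` to `u`. In any other factorization the factor from `K` is at least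
as long, so the factor from `J` is a prefix (dually, a suffix) of `u`, and `J` absorbs the rest. -/
theorem isCancellative : ResiduatedLattice.IsCancellative (WordIdeal X) := by
  constructor
  · intro I J K h u hu
    obtain ⟨w, hw, hmin⟩ := K.exists_shortest
    obtain ⟨v, hv, w', hw', e⟩ := h (mem_mul.2 ⟨u, hu, w, hw, rfl⟩)
    have hlen : v.length ≤ u.length := by
      have := congrArg List.length e
      have := hmin w' hw'
      simp only [List.length_append] at *
      omega
    obtain ⟨x, rfl⟩ := List.prefix_of_prefix_length_le ⟨w', e⟩ ⟨w, rfl⟩ hlen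
    exact J.append_right x hv
  · intro I J K h u hu
    obtain ⟨w, hw, hmin⟩ := K.exists_shortest
    obtain ⟨w', hw', v, hv, e⟩ := h (mem_mul.2 ⟨w, hw, u, hu, rfl⟩)
    have hlen : v.length ≤ u.length := by
      have := congrArg List.length e
      have := hmin w' hw'
      simp only [List.length_append] at *
      omega
    obtain ⟨x, rfl⟩ := List.suffix_of_suffix_length_le ⟨w', e⟩ ⟨w, rfl⟩ hlen
    exact J.append_left x hv

/-- Of two factorizations of the same word, the longer of the competing factors extends the shorter
one and hence lies in both ideals. -/
theorem mulDistribInf : ResiduatedLattice.MulDistribInf (WordIdeal X) := by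
  have mono := @ResiduatedLattice.mul_mono (WordIdeal X) _
  constructor
  · intro I J K
    refine le_antisymm (le_inf (mono le_rfl inf_le_left) (mono le_rfl inf_le_right)) ?_
    rintro _ ⟨⟨u, hu, v, hv, rfl⟩, u', hu', v', hv', e⟩
    rcases le_total v.length v'.length with hlen | hlen
    · obtain ⟨x, rfl⟩ := List.suffix_of_suffix_length_le ⟨u, rfl⟩ ⟨u', e⟩ hlen
      exact ⟨u', hu', _, ⟨J.append_left x hv, hv'⟩, e⟩
    · obtain ⟨x, rfl⟩ := List.suffix_of_suffix_length_le ⟨u', e⟩ ⟨u, rfl⟩ hlen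
      exact ⟨u, hu, _, ⟨hv, K.append_left x hv'⟩, rfl⟩
  · intro I J K
    refine le_antisymm (le_inf (mono inf_le_left le_rfl) (mono inf_le_right le_rfl)) ?_
    rintro _ ⟨⟨u, hu, v, hv, rfl⟩, u', hu', v', hv', e⟩
    rcases le_total u.length u'.length with hlen | hlen
    · obtain ⟨x, rfl⟩ := List.prefix_of_prefix_length_le ⟨v, rfl⟩ ⟨v', e⟩ hlen
      exact ⟨_, ⟨I.append_right x hu, hu'⟩, v', hv', e⟩
    · obtain ⟨x, rfl⟩ := List.prefix_of_prefix_length_le ⟨v', e⟩ ⟨v, rfl⟩ hlen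
      exact ⟨_, ⟨hu, J.append_right x hu'⟩, v, hv, rfl⟩

end WordIdeal

/-! ### Joins of products and the nucleus they induce. -/

namespace ResiduatedLattice

theorem exists_isLUB_of_wellFoundedGT {α : Type*} [SemilatticeSup α] [WellFoundedGT α]
    {s : Set α} (hs : s.Nonempty) : ∃ a, IsLUB s a := by
  -- A maximal element of a set closed under binary joins is its greatest element.
  obtain ⟨m, hm, hmax⟩ := exists_maximal_of_wellFoundedGT (· ∈ supClosure s) (hs.mono subset_supClosure)
  have h : IsLUB (supClosure s) m :=
    ⟨fun x hx => le_sup_left.trans (hmax (supClosed_supClosure hx hm) le_sup_right),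
      fun b hb => hb hm⟩
  exact ⟨m, isLUB_supClosure.1 h⟩

theorem IsDuallyWPO.wellFoundedGT {α : Type*} [PartialOrder α] (h : IsDuallyWPO α) :
    WellFoundedGT α :=
  ⟨RelEmbedding.wellFounded_iff_isEmpty.2 ⟨fun f =>
    h.1 ⟨f, strictMono_nat_of_lt_succ fun n => f.map_rel_iff.2 n.lt_succ_self⟩⟩⟩

theorem isDuallyWPO_of_finite (α : Type*) [PartialOrder α] [Finite α] : IsDuallyWPO α :=
  ⟨fun ⟨f, hf⟩ => not_injective_infinite_finite f hf.injective, fun s _ => s.toFinite⟩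

section

variable {M : Type*} [ResiduatedLattice M]

theorem IsIntegral.mul_le_left (hM : IsIntegral M) (a b : M) : a * b ≤ a :=
  (mul_mono le_rfl (hM b)).trans (mul_one a).le

theorem IsIntegral.mul_le_right (hM : IsIntegral M) (a b : M) : a * b ≤ b :=
  (mul_mono (hM a) le_rfl).trans (one_mul b).le

/-- The ideal of the words whose product is below `a`. -/
def IsIntegral.wordsBelow (hM : IsIntegral M) (a : M) : WordIdeal M where
  carrier := {w | w.prod ≤ a}
  nonempty := ⟨[a], by simp⟩
  -- Integrality is what makes this set absorb words on either side.
  append_left := fun u v h => by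
    rw [Set.mem_ofPred_eq, List.prod_append]
    exact (hM.mul_le_right _ _).trans h
  append_right := fun v h => by
    rw [Set.mem_ofPred_eq, List.prod_append]
    exact (hM.mul_le_left _ _).trans h

theorem exists_isLUB_prod [WellFoundedGT M] (I : WordIdeal M) :
    ∃ a, IsLUB (List.prod '' I.carrier) a :=
  exists_isLUB_of_wellFoundedGT (I.nonempty.image _)

/-- The join of the products of the words of an ideal. -/
noncomputable def wordSup [WellFoundedGT M] (I : WordIdeal M) : M :=
  (exists_isLUB_prod I).choose

theorem wordSup_le_iff [WellFoundedGT M] {I : WordIdeal M} {a : M} :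
    wordSup I ≤ a ↔ ∀ w ∈ I.carrier, w.prod ≤ a := by
  exact (isLUB_le_iff (exists_isLUB_prod I).choose_spec).trans Set.forall_mem_image

theorem prod_le_wordSup [WellFoundedGT M] {I : WordIdeal M} {w : List M} (hw : w ∈ I.carrier) :
    w.prod ≤ wordSup I :=
  wordSup_le_iff.1 le_rfl w hw

theorem wordSup_mul [WellFoundedGT M] (I J : WordIdeal M) :
    wordSup (I * J) = wordSup I * wordSup J := by
  refine le_antisymm (wordSup_le_iff.2 ?_) ?_
  · rintro _ ⟨u, hu, v, hv, rfl⟩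
    rw [List.prod_append]
    exact mul_mono (prod_le_wordSup hu) (prod_le_wordSup hv)
  -- Residuals move one factor at a time to the right, so each join can be tested on single words.
  · rw [← le_rres_iff, wordSup_le_iff]
    intro u hu
    rw [le_rres_iff, ← le_lres_iff, wordSup_le_iff]
    intro v hv
    rw [le_lres_iff, ← List.prod_append]
    exact prod_le_wordSup ⟨u, hu, v, hv, rfl⟩

theorem wordSup_wordsBelow [WellFoundedGT M] (hM : IsIntegral M) (a : M) :
    wordSup (hM.wordsBelow a) = a :=
  le_antisymm (wordSup_le_iff.2 fun _ h => h) <| by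
    simpa using prod_le_wordSup (I := hM.wordsBelow a) (w := [a])
      (show [a].prod ≤ a by simp)

theorem gc_wordSup_wordsBelow [WellFoundedGT M] (hM : IsIntegral M) :
    GaloisConnection (wordSup (M := M)) hM.wordsBelow :=
  fun _ _ => wordSup_le_iff

/-- The nucleus sending an ideal `I` to the ideal of all words whose product is below the join of
the products of the words of `I`. -/
noncomputable def IsIntegral.wordNucleus [WellFoundedGT M] (hM : IsIntegral M) :
    RLNucleus (WordIdeal M) where
  toClosureOperator := (gc_wordSup_wordsBelow hM).closureOperator
  map_mul_le' I J := by
    change hM.wordsBelow (wordSup I) * hM.wordsBelow (wordSup J) ≤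
      hM.wordsBelow (wordSup (I * J))
    -- By adjunction the claim compares two joins, both equal to `wordSup I * wordSup J`.
    rw [← gc_wordSup_wordsBelow hM, wordSup_mul, wordSup_wordsBelow, wordSup_wordsBelow,
      wordSup_mul]

theorem IsIntegral.wordNucleus_apply [WellFoundedGT M] (hM : IsIntegral M) (I : WordIdeal M) :
    hM.wordNucleus I = hM.wordsBelow (wordSup I) := rfl

/-- An integral residuated lattice without infinite ascending chains is a nuclear image of the
residuated lattice of nonempty ideals of words over it. -/
theorem IsIntegral.isNuclearImageOf_wordIdeal [WellFoundedGT M] (hM : IsIntegral M) :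
    IsNuclearImageOf M (WordIdeal M) := by
  refine ⟨hM.wordNucleus, ⟨?_⟩⟩
  exact
    { toFun := fun a => ⟨hM.wordsBelow a, by rw [hM.wordNucleus_apply, wordSup_wordsBelow]⟩
      invFun := fun I => wordSup I.1
      left_inv := wordSup_wordsBelow hM
      right_inv := fun I => Subtype.ext I.2
      map_mul' := fun a b => Subtype.ext <| by
        change hM.wordsBelow (a * b) = hM.wordNucleus (hM.wordsBelow a * hM.wordsBelow b)
        rw [hM.wordNucleus_apply, wordSup_mul, wordSup_wordsBelow, wordSup_wordsBelow]
      map_le_map_iff' := fun {a b} => by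
        change hM.wordsBelow a ≤ hM.wordsBelow b ↔ a ≤ b
        rw [← gc_wordSup_wordsBelow hM, wordSup_wordsBelow] }

/-! ### Integrality of nuclear images. -/

theorem IsNuclearImageOf.isIntegral {L : Type*} [ResiduatedLattice L] (h : IsNuclearImageOf M L)
    (hL : IsIntegral L) : IsIntegral M := by
  obtain ⟨γ, ⟨e⟩⟩ := h
  intro a
  refine e.map_le_map_iff'.1 (le_of_le_of_eq ?_ (map_one e.toMulEquiv).symm)
  exact (hL (e a).1).trans (γ.le_map 1)

/-- A nuclear image of a cancellative residuated lattice is integral as soon as it has a top. -/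
theorem IsNuclearImageOf.isIntegral_of_isCancellative {L : Type*} [ResiduatedLattice L]
    (h : IsNuclearImageOf M L) (hL : IsCancellative L) {t : M} (ht : ∀ a, a ≤ t) :
    IsIntegral M := by
  obtain ⟨γ, ⟨e⟩⟩ := h
  refine fun a => (ht a).trans ?_
  have h1 : e t * e t ≤ e t := by
    rw [← map_mul]
    exact e.map_le_map_iff'.2 (ht _)
  -- The product is now that of `L`, which lies below its closure, so cancellation in `L` applies.
  have h2 : (e t).1 * (e t).1 ≤ 1 * (e t).1 := by
    rw [one_mul]
    exact (γ.le_map _).trans h1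
  refine e.map_le_map_iff'.1 (le_of_le_of_eq ?_ (map_one e.toMulEquiv).symm)
  exact (hL.1 _ _ _ h2).trans (γ.le_map 1)

end

end ResiduatedLattice

theorem mainTheorem6 :
    (∀ (M : Type u) [ResiduatedLattice M],
      List.TFAE
        [ResiduatedLattice.IsDuallyWPO M ∧ ResiduatedLattice.IsIntegral M,
          ResiduatedLattice.IsDuallyWPO M ∧
            ∃ (L : Type u) (_ : ResiduatedLattice L),
              ResiduatedLattice.IsIntegral L ∧ ResiduatedLattice.IsCancellative L ∧
                ResiduatedLattice.IsNuclearImageOf M L,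
          ResiduatedLattice.IsDuallyWPO M ∧
            ∃ (L : Type u) (_ : ResiduatedLattice L),
              ResiduatedLattice.IsDistributive L ∧ ResiduatedLattice.IsIntegral L ∧
                ResiduatedLattice.IsCancellative L ∧ ResiduatedLattice.MulDistribInf L ∧
                  ResiduatedLattice.IsNuclearImageOf M L]) ∧
    (∀ (M : Type u) [ResiduatedLattice M] [Finite M],
      List.TFAE
        [ResiduatedLattice.IsIntegral M,
          ∃ (L : Type u) (_ : ResiduatedLattice L),
            ResiduatedLattice.IsIntegral L ∧ ResiduatedLattice.IsCancellative L ∧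
              ResiduatedLattice.IsNuclearImageOf M L,
          ∃ (L : Type u) (_ : ResiduatedLattice L),
            ResiduatedLattice.IsCancellative L ∧ ResiduatedLattice.IsNuclearImageOf M L]) := by
  open ResiduatedLattice in
  refine ⟨fun M _ => ?_, fun M _ _ => ?_⟩
  · tfae_have 1 → 3 := fun ⟨hw, hM⟩ =>
      have := hw.wellFoundedGT
      ⟨hw, WordIdeal M, inferInstance, WordIdeal.isDistributive, WordIdeal.isIntegral,
        WordIdeal.isCancellative, WordIdeal.mulDistribInf, hM.isNuclearImageOf_wordIdeal⟩
    tfae_have 3 → 2 := fun ⟨hw, L, _, _, hi, hc, _, hn⟩ => ⟨hw, L, _, hi, hc, hn⟩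
    tfae_have 2 → 1 := fun ⟨hw, L, _, hi, _, hn⟩ => ⟨hw, hn.isIntegral hi⟩
    tfae_finish
  · tfae_have 1 → 2 := fun hM =>
      have := (isDuallyWPO_of_finite M).wellFoundedGT
      ⟨WordIdeal M, inferInstance, WordIdeal.isIntegral, WordIdeal.isCancellative,
        hM.isNuclearImageOf_wordIdeal⟩
    tfae_have 2 → 3 := fun ⟨L, _, _, hc, hn⟩ => ⟨L, _, hc, hn⟩
    tfae_have 3 → 1 := fun ⟨L, _, hc, hn⟩ => by
      -- A maximal element of a lattice is its top.
      obtain ⟨t, ht⟩ := Finite.exists_le_maximal (p := fun _ : M => True) (a := 1) trivial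
      exact hn.isIntegral_of_isCancellative hc
        (fun a => le_sup_left.trans (ht.2.2 (y := a ⊔ t) trivial le_sup_right))
    tfae_finish
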